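/- **Setting.** Let $\mathcal{D}$ be a probability distribution of pairs $(X,Y)\in\mathcal{X}\times\{0,1\}$. A decision rule is a measurable function $h:\mathcal{X}\to\{0,1\}$. For $c\in(0,1)$ its risk is $\mathcal{R}_c(h)=c\,\mathbb{P}(h(X)=1,Y=0)+(1-c)\,\mathbb{P}(h(X)=0,Y=1)$ (defined by the same formula for $c\in\{0,1\}$). For a hypothesis class $\mathcal{H}$ (a set of decision rules) let $\mathrm{opt}_{\mathcal{D}}(\mathcal{H})=\{h\in\mathcal{H} : h\in\arg\min_{g\in\mathcal{H}}\mathcal{R}_c(g)\text{ for some }c\in(0,1)\}$. A class is monotone if for any two of its rules $h,h'$ either $h\ge h'$ everywhere or $h\le h'$ everywhere. Write $h_c$ for a rule that is optimal in $\mathcal{H}$ for the parameter $c$. The induced posterior probability $q_{\mathcal{H}}(x)$ is the common value, where they agree, of $\sup(\{c\in[0,1] : h_c(x)=1\text{ for some optimal }h_c\}\cup\{0\})$ and $\inf(\{c\in[0,1] : h_c(x)=0\text{ for some optimal }h_c\}\cup\{1\})$. For a class $\tilde{\mathcal{H}}$ put $\mathrm{MD}(h,\tilde{\mathcal{H}})=\inf_{\tilde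 h\in\tilde{\mathcal{H}}}\mathbb{P}(\tilde h(X)\ne h(X))$. Let $\mathbb{H}$ be a family of hypothesis classes, $\mathcal{H}\in\mathbb{H}$, $c\in(0,1)$, $h_c\in\arg\min_{h\in\mathcal{H}}\mathcal{R}_c(h)$ and $\alpha\ge 0$. Then $h_c$ and $\mathbb{H}$ are $\alpha$-MD-smooth if $\mathrm{opt}_{\mathcal{D}}(\tilde{\mathcal{H}})$ is monotone for every $\tilde{\mathcal{H}}\in\mathbb{H}$, and for every $c'\in(0,1)$ there is $h_{c'}\in\arg\min_{h\in\mathcal{H}}\mathcal{R}_{c'}(h)$ with $$\mathrm{MD}(h_{c'},\mathrm{opt}_{\mathcal{D}}(\tilde{\mathcal{H}}))\le(1+\alpha|c'-c|)\,\mathrm{MD}(h_c,\mathrm{opt}_{\mathcal{D}}(\tilde{\mathcal{H}}))\qquad\text{for all }\tilde{\mathcal{H}}\in\mathbb{H}.$$ **Theorem (unknown suboptimal decision maker).** There is a universal constant $C>0$ such that the following holds. Let $\epsilon>0$, $\delta>0$, let $h_c$ be optimal for $c\in(0,1)$ in $\mathcal{H}\in\mathbb{H}$, and let $h_c$ and $\mathbb{H}$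 be $\alpha$-MD-smooth, $\alpha\ge0$. Let $p_c>0$ be such that for all $0<\rho\le\epsilon$ $$\mathbb{P}(q_{\mathcal{H}}(X)\in(c,c+\rho))\ge p_c\rho\quad\text{and}\quad\mathbb{P}(q_{\mathcal{H}}(X)\in(c-\rho,c))\ge p_c\rho .$$ Let $\mathcal{G}=\bigcup_{\mathcal{H}'\in\mathbb{H}}\mathcal{H}'$ have VC-dimension at most $d$, and let $\mathcal{G}$ satisfy the usual measurability requirement of VC theory for the target $h_c$: for all $n$ and $\eta>0$, the set of $(x,y)\in\mathcal{X}^n\times\mathcal{X}^n$ for which some $g\in\mathcal{G}$ with $\mathbb{P}(g(X)\ne h_c(X))\ge\eta$ has $g(x_i)=h_c(x_i)$ for all $i$ and $g(y_i)\ne h_c(y_i)$ for at least $\eta n/2$ indices $i$ is measurable up to null sets. Let $x_1,\dots,x_m$ be i.i.d. with the law of $X$, let $\hat y_i=h_c(x_i)$, and let $$m\ \ge\ C\left(\frac{\alpha}{\epsilon}+\frac1{\epsilon^2}\right)\frac{d\,\log\!\left(2+\frac{1}{p_c}\left(\frac{\alpha}{\epsilon}+\frac1{\epsilon^2}\right)\right)+\log(1/\delta)}{p_c},$$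 which is of the form $\tilde O\big[(\frac{\alpha}{\epsilon}+\frac1{\epsilon^2})\frac{d+\log(1/\delta)}{p_c}\big]$. Then with probability at least $1-\delta$ over the sample, every $\hat c\in(0,1)$ for which there are a class $\hat{\mathcal{H}}\in\mathbb{H}$ and a rule $\hat h\in\arg\min_{h\in\hat{\mathcal{H}}}\mathcal{R}_{\hat c}(h)$ consistent with the sample, i.e. $\hat h(x_i)=\hat y_i$ for $i=1,\dots,m$, satisfies $|\hat c-c|\le\epsilon$. -/

import Mathlib

open MeasureTheory Set
open scoped ENNReal

noncomputable section

/-! Observations live in a measurable space `𝒳`, correct decisions in `Bool` (`true` is `1`), a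
decision rule is a function `𝒳 → Bool`, a hypothesis class is a set of decision rules, and a family
of hypothesis classes is a set of hypothesis classes. -/

/-- The loss with parameter `c`: a false positive costs `c`, a false negative costs `1 - c`, and a
correct decision costs nothing. The first argument is the decision made, the second the correct
one. -/
def idtLoss (c : ℝ) : Bool → Bool → ℝ
  | true, false => c
  | false, true => 1 - c
  | true, true => 0
  | false, false => 0

/-- The risk `R_c(h) = E[ℓ_c(h(X), Y)]` for `(X, Y) ∼ D`. -/
def idtRisk {𝒳 : Type*} [MeasurableSpace 𝒳] (D : Measure (𝒳 × Bool)) (c : ℝ) (h : 𝒳 → Bool) : ℝ :=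
  ∫ z, idtLoss c (h z.1) z.2 ∂D

/-- `argmin_{h ∈ H} R_c(h)`: the decision rules in `H` that are optimal for the parameter `c`. -/
def optimalRules {𝒳 : Type*} [MeasurableSpace 𝒳] (D : Measure (𝒳 × Bool)) (H : Set (𝒳 → Bool))
    (c : ℝ) : Set (𝒳 → Bool) :=
  {h | h ∈ H ∧ ∀ g ∈ H, idtRisk D c h ≤ idtRisk D c g}

/-- The optimal subset `opt_D(H)`: the rules in `H` that are optimal for some loss parameter. -/
def optSubset {𝒳 : Type*} [MeasurableSpace 𝒳] (D : Measure (𝒳 × Bool)) (H : Set (𝒳 → Bool)) :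
    Set (𝒳 → Bool) :=
  {h | ∃ c ∈ Ioo (0 : ℝ) 1, h ∈ optimalRules D H c}

/-- A hypothesis class is monotone if any two of its rules are pointwise comparable. -/
def MonotoneClass {𝒳 : Type*} (H : Set (𝒳 → Bool)) : Prop :=
  ∀ h ∈ H, ∀ h' ∈ H, (∀ x, h' x ≤ h x) ∨ (∀ x, h x ≤ h' x)

/-- `sup ({c ∈ [0,1] | h_c(x) = 1} ∪ {0})`, where `h_c` is optimal in `H` for `c`. -/
def upperPosterior {𝒳 : Type*} [MeasurableSpace 𝒳] (D : Measure (𝒳 × Bool)) (H : Set (𝒳 → Bool))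
    (x : 𝒳) : ℝ :=
  sSup ({c : ℝ | c ∈ Icc (0 : ℝ) 1 ∧ ∃ h ∈ optimalRules D H c, h x = true} ∪ {0})

/-- `inf ({c ∈ [0,1] | h_c(x) = 0} ∪ {1})`, where `h_c` is optimal in `H` for `c`. -/
def lowerPosterior {𝒳 : Type*} [MeasurableSpace 𝒳] (D : Measure (𝒳 × Bool)) (H : Set (𝒳 → Bool))
    (x : 𝒳) : ℝ :=
  sInf ({c : ℝ | c ∈ Icc (0 : ℝ) 1 ∧ ∃ h ∈ optimalRules D H c, h x = false} ∪ {1})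

/-- `t` is the value at `x` of the induced posterior probability `q_H`, that is, the common value
of the upper and the lower one. -/
def IsInducedPosterior {𝒳 : Type*} [MeasurableSpace 𝒳] (D : Measure (𝒳 × Bool))
    (H : Set (𝒳 → Bool)) (x : 𝒳) (t : ℝ) : Prop :=
  upperPosterior D H x = t ∧ lowerPosterior D H x = t

/-- The minimum disagreement `inf_{g ∈ G} P(g(X) ≠ h(X))` (infinite if `G` is empty). -/
def minDisagreement {𝒳 : Type*} [MeasurableSpace 𝒳] (D : Measure (𝒳 × Bool)) (h : 𝒳 → Bool)
    (G : Set (𝒳 → Bool)) : ℝ≥0∞ :=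
  ⨅ g ∈ G, D.fst {x | g x ≠ h x}

/-- `α`-MD-smoothness of the family `F` and the rule `h`, which is optimal for `c` in `H ∈ F`. The
rule `h'` is the `h_{c'}` of the definition: for each parameter `c'`, some rule that is optimal for
`c'` in `H`. -/
def MDSmooth {𝒳 : Type*} [MeasurableSpace 𝒳] (D : Measure (𝒳 × Bool))
    (F : Set (Set (𝒳 → Bool))) (H : Set (𝒳 → Bool)) (c : ℝ) (h : 𝒳 → Bool) (α : ℝ) : Prop :=
  (∀ H' ∈ F, MonotoneClass (optSubset D H')) ∧
    ∀ c' ∈ Ioo (0 : ℝ) 1, ∃ h' ∈ optimalRules D H c', ∀ H' ∈ F,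
      minDisagreement D h' (optSubset D H') ≤
        ENNReal.ofReal (1 + α * |c' - c|) * minDisagreement D h (optSubset D H')

/-- The class `G` shatters the finite set `S` if it realizes every labelling of `S`. -/
def ClassShatters {𝒳 : Type*} (G : Set (𝒳 → Bool)) (S : Finset 𝒳) : Prop :=
  ∀ f : 𝒳 → Bool, ∃ g ∈ G, ∀ x ∈ S, g x = f x

/-- The VC-dimension: the supremum of the sizes of the shattered finite sets. -/
def classVCDim {𝒳 : Type*} (G : Set (𝒳 → Bool)) : ℕ∞ :=
  ⨆ S : {S : Finset 𝒳 // ClassShatters G S}, (S.1.card : ℕ∞)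

/-- The usual measurability requirement of VC theory (`G` is well behaved for the target `h`): for
all `n` and `η`, the set of double samples for which some rule in `G` of error at least `η` makes
no error on the first sample and at least `η n / 2` errors on the second one is measurable (up to
null sets). -/
def WellBehaved {𝒳 : Type*} [MeasurableSpace 𝒳] (P : Measure 𝒳) (h : 𝒳 → Bool)
    (G : Set (𝒳 → Bool)) : Prop :=
  ∀ (n : ℕ) (η : ℝ), 0 < η →
    NullMeasurableSet
      {s : (Fin n → 𝒳) × (Fin n → 𝒳) | ∃ g ∈ G, ENNReal.ofReal η ≤ P {x | g x ≠ h x} ∧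
        (∀ i, g (s.1 i) = h (s.1 i)) ∧
        η * n / 2 ≤ ((Finset.univ.filter fun i => g (s.2 i) ≠ h (s.2 i)).card : ℝ)}
      ((Measure.pi fun _ : Fin n => P).prod (Measure.pi fun _ : Fin n => P))

end

/-! The proof has a geometric and a statistical half.

Geometry (`error_ge_of_parameter_far`): a rule `h'` optimal for `c'` in some class of the family,
with `c'` farther than `ε` from `c`, must differ from `h` with probability at least `η = p / (12 (α
/ ε + 1 / ε²))`. Take `c' > c + ε` and suppose that the disagreement is smaller. Let `s = c + ε /
2`. Smoothness yields `k` optimal for `s` in `H` and `g` in the optimal subset of `H'` with `g`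
close to `k`. The set `B = {h = 1, k = 0}` contains the points with induced posterior in `(c, s)`,
so it has mass at least `p ε / 2`, and `A = {h' = 1, g = 0}` is nearly the same set. Optimality of
`k` against `h` gives `P(Y = 1 | B) ≤ s`, and optimality of `h'` against `g` gives `P(Y = 1 | A) ≥
c'`. As `c' - s > ε / 2`, sets of this mass cannot be that close. The case `c' < c - ε` is the
mirror image.

Statistics (`exists_measurableSet_consistent_error_lt`): by double sampling, random swaps and the
Sauer–Shelah bound, with high probability every rule of the union of the family consistent with the
sample has error below `η`. Hence no consistent rule is optimal for a parameter far from `c`. -/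

/-! ### Risk differences of comparable rules -/

lemma measurable_idtLoss_comp {𝒳 : Type*} [MeasurableSpace 𝒳] (c : ℝ) {h : 𝒳 → Bool}
    (hh : Measurable h) : Measurable fun z : 𝒳 × Bool => idtLoss c (h z.1) z.2 := by
  have h1 : Measurable fun b : Bool × Bool => idtLoss c b.1 b.2 := measurable_of_countable _
  exact h1.comp ((hh.comp measurable_fst).prodMk measurable_snd)

lemma integrable_idtLoss_comp {𝒳 : Type*} [MeasurableSpace 𝒳] (D : Measure (𝒳 × Bool))
    [IsFiniteMeasure D] (c : ℝ) {h : 𝒳 → Bool} (hh : Measurable h) :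
    Integrable (fun z : 𝒳 × Bool => idtLoss c (h z.1) z.2) D := by
  refine Integrable.of_bound (measurable_idtLoss_comp c hh).aestronglyMeasurable
    (|c| + |1 - c|) (ae_of_all _ fun z => ?_)
  have h1 := abs_nonneg c
  have h2 := abs_nonneg (1 - c)
  cases h z.1 <;> cases z.2 <;> simp only [idtLoss, Real.norm_eq_abs, abs_zero] <;> linarith

/-- The probability that `X ∈ A` and `Y = 1`. -/
noncomputable def positiveMass {𝒳 : Type*} [MeasurableSpace 𝒳] (D : Measure (𝒳 × Bool))
    (A : Set 𝒳) : ℝ :=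
  D.real {z | z.1 ∈ A ∧ z.2 = true}

lemma measurableSet_disagree {𝒳 : Type*} [MeasurableSpace 𝒳] {g h : 𝒳 → Bool}
    (hg : Measurable g) (hh : Measurable h) : MeasurableSet {x | h x = true ∧ g x = false} :=
  (hh (measurableSet_singleton true)).inter (hg (measurableSet_singleton false))

lemma measurableSet_ne_rule {𝒳 : Type*} [MeasurableSpace 𝒳] {g h : 𝒳 → Bool}
    (hg : Measurable g) (hh : Measurable h) : MeasurableSet {x | g x ≠ h x} :=
  (measurableSet_eq_fun hg hh).compl

/-- The rules differ only where `h = 1` and `g = 0`. There `h` pays `c` if `Y = 0` and saves `1 - c`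
if `Y = 1`, so the difference of losses is `c - 1{Y = 1}`. -/
lemma idtRisk_sub_of_le {𝒳 : Type*} [MeasurableSpace 𝒳] (D : Measure (𝒳 × Bool))
    [IsProbabilityMeasure D] (c : ℝ) {g h : 𝒳 → Bool} (hg : Measurable g) (hh : Measurable h)
    (hle : ∀ x, g x ≤ h x) :
    idtRisk D c h - idtRisk D c g =
      c * D.fst.real {x | h x = true ∧ g x = false} -
        positiveMass D {x | h x = true ∧ g x = false} := by
  have hA := measurableSet_disagree hg hh
  have hA1 : MeasurableSet (Prod.fst ⁻¹' {x | h x = true ∧ g x = false} : Set (𝒳 × Bool)) :=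
    measurable_fst hA
  have hA2 : MeasurableSet {z : 𝒳 × Bool | z.1 ∈ {x | h x = true ∧ g x = false} ∧ z.2 = true} :=
    hA1.inter (measurable_snd (measurableSet_singleton true))
  have hfst : D.fst.real {x | h x = true ∧ g x = false} =
      D.real (Prod.fst ⁻¹' {x | h x = true ∧ g x = false}) := by
    rw [measureReal_def, Measure.fst_apply hA, measureReal_def]
  rw [hfst, positiveMass, idtRisk, idtRisk,
    ← integral_sub (integrable_idtLoss_comp D c hh) (integrable_idtLoss_comp D c hg),
    ← integral_indicator_one hA1, ← integral_indicator_one hA2, ← integral_const_mul,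
    ← integral_sub]
  · refine integral_congr_ae (ae_of_all _ fun z => ?_)
    have hz : g z.1 = true → h z.1 = true := fun h1 =>
      Bool.eq_true_of_true_le (h1 ▸ hle z.1)
    by_cases h1 : h z.1 = true <;> by_cases h2 : g z.1 = true <;> by_cases h3 : z.2 = true <;>
      simp_all [idtLoss, indicator]
  · exact ((integrable_const 1).indicator hA1).const_mul c
  · exact (integrable_const 1).indicator hA2

/-! ### The induced posterior as a threshold for optimal rules -/

lemma true_of_lt_inducedPosterior {𝒳 : Type*} [MeasurableSpace 𝒳] {D : Measure (𝒳 × Bool)}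
    {H : Set (𝒳 → Bool)} {x : 𝒳} {t c : ℝ} (ht : IsInducedPosterior D H x t)
    (hc : c ∈ Icc (0 : ℝ) 1) {h : 𝒳 → Bool} (hh : h ∈ optimalRules D H c) (hlt : c < t) :
    h x = true := by
  by_contra hx
  have hx' : h x = false := by simpa using hx
  have : lowerPosterior D H x ≤ c := by
    refine csInf_le ⟨0, ?_⟩ (Or.inl ⟨hc, h, hh, hx'⟩)
    rintro y (hy | hy)
    · exact hy.1.1
    · rw [mem_singleton_iff.1 hy]; exact zero_le_one
  linarith [ht.2]

lemma false_of_inducedPosterior_lt {𝒳 : Type*} [MeasurableSpace 𝒳] {D : Measure (𝒳 × Bool)}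
    {H : Set (𝒳 → Bool)} {x : 𝒳} {t c : ℝ} (ht : IsInducedPosterior D H x t)
    (hc : c ∈ Icc (0 : ℝ) 1) {h : 𝒳 → Bool} (hh : h ∈ optimalRules D H c) (hlt : t < c) :
    h x = false := by
  by_contra hx
  have hx' : h x = true := by simpa using hx
  have : c ≤ upperPosterior D H x := by
    refine le_csSup ⟨1, ?_⟩ (Or.inl ⟨hc, h, hh, hx'⟩)
    rintro y (hy | hy)
    · exact hy.1.2
    · rw [mem_singleton_iff.1 hy]; exact zero_le_one
  linarith [ht.1]

/-! ### Positive mass on nearby sets -/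

lemma positiveMass_le_add {𝒳 : Type*} [MeasurableSpace 𝒳] (D : Measure (𝒳 × Bool))
    [IsProbabilityMeasure D] {A B : Set 𝒳} (hA : MeasurableSet A) (hB : MeasurableSet B) :
    positiveMass D A ≤ positiveMass D B + D.fst.real (A \ B) := by
  have h1 : D.fst.real (A \ B) = D.real (Prod.fst ⁻¹' (A \ B)) := by
    rw [measureReal_def, Measure.fst_apply (hA.diff hB), measureReal_def]
  rw [h1]
  refine (measureReal_mono ?_).trans (measureReal_union_le _ _)
  rintro z ⟨hz, hy⟩
  by_cases hzB : z.1 ∈ B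
  · exact Or.inl ⟨hzB, hy⟩
  · exact Or.inr ⟨hz, hzB⟩

lemma measureReal_le_add_sdiff {𝒳 : Type*} [MeasurableSpace 𝒳] (μ : Measure 𝒳)
    [IsFiniteMeasure μ] (A B : Set 𝒳) : μ.real A ≤ μ.real B + μ.real (A \ B) := by
  refine (measureReal_mono ?_).trans (measureReal_union_le _ _)
  intro z hz
  by_cases hzB : z ∈ B
  · exact Or.inl hzB
  · exact Or.inr ⟨hz, hzB⟩

lemma disagree_sdiff_subset {𝒳 : Type*} (a b a' b' : 𝒳 → Bool) :
    {x | a x = true ∧ b x = false} \ {x | a' x = true ∧ b' x = false} ⊆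
      {x | a x ≠ a' x} ∪ {x | b x ≠ b' x} := by
  rintro x ⟨⟨h1, h2⟩, h3⟩
  by_contra h4
  simp only [mem_union, mem_ofPred_eq, not_or, not_not] at h4
  exact h3 ⟨h4.1 ▸ h1, h4.2 ▸ h2⟩

/-- A point in exactly one of the two sets is one where `a, a'` or `b, b'` differ. Bounding the
union of the two differences at once avoids a factor 2. -/
lemma measureReal_disagree_sdiff_add_le {𝒳 : Type*} [MeasurableSpace 𝒳] (μ : Measure 𝒳)
    [IsFiniteMeasure μ] {a b a' b' : 𝒳 → Bool} (ha : Measurable a) (hb : Measurable b)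
    (ha' : Measurable a') (hb' : Measurable b') :
    μ.real ({x | a x = true ∧ b x = false} \ {x | a' x = true ∧ b' x = false}) +
      μ.real ({x | a' x = true ∧ b' x = false} \ {x | a x = true ∧ b x = false}) ≤
      μ.real {x | a x ≠ a' x} + μ.real {x | b x ≠ b' x} := by
  rw [← measureReal_union disjoint_sdiff_sdiff
    ((measurableSet_disagree hb' ha').diff (measurableSet_disagree hb ha))]
  refine (measureReal_mono (union_subset (disagree_sdiff_subset a b a' b') ?_)).trans
    (measureReal_union_le _ _)
  refine (disagree_sdiff_subset a' b' a b).trans (union_subset_union ?_ ?_) <;>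
    exact fun x hx => Ne.symm hx

/-- If `P(Y = 1 | B) ≤ s` and `t ≤ P(Y = 1 | A)`, where `s < t` and `A` is close to `B`, then `A`
has small probability. -/
lemma sub_mul_le_of_positiveMass {𝒳 : Type*} [MeasurableSpace 𝒳] (D : Measure (𝒳 × Bool))
    [IsProbabilityMeasure D] {A B : Set 𝒳} (hA : MeasurableSet A) (hB : MeasurableSet B)
    {s t r : ℝ} (hs0 : 0 ≤ s) (hs1 : s ≤ 1)
    (hr : D.fst.real (A \ B) + D.fst.real (B \ A) ≤ r)
    (hQB : positiveMass D B ≤ s * D.fst.real B) (hQA : t * D.fst.real A ≤ positiveMass D A) :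
    (t - s) * D.fst.real A ≤ r := by
  have h1 := positiveMass_le_add D hA hB
  have h2 := mul_le_mul_of_nonneg_left (measureReal_le_add_sdiff D.fst B A) hs0
  have h3 := mul_le_of_le_one_left (measureReal_nonneg (μ := D.fst) (s := B \ A)) hs1
  linarith

/-- If `s ≤ P(Y = 1 | B)` and `P(Y = 1 | A) ≤ t`, where `t < s` and `A` is close to `B`, then `A`
has small probability. -/
lemma sub_mul_le_of_positiveMass' {𝒳 : Type*} [MeasurableSpace 𝒳] (D : Measure (𝒳 × Bool))
    [IsProbabilityMeasure D] {A B : Set 𝒳} (hA : MeasurableSet A) (hB : MeasurableSet B)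
    {s t r : ℝ} (hs0 : 0 ≤ s) (hs1 : s ≤ 1)
    (hr : D.fst.real (A \ B) + D.fst.real (B \ A) ≤ r)
    (hQB : s * D.fst.real B ≤ positiveMass D B) (hQA : positiveMass D A ≤ t * D.fst.real A) :
    (s - t) * D.fst.real A ≤ r := by
  have h1 := positiveMass_le_add D hB hA
  have h2 := mul_le_mul_of_nonneg_left (measureReal_le_add_sdiff D.fst A B) hs0
  have h3 := mul_le_of_le_one_left (measureReal_nonneg (μ := D.fst) (s := A \ B)) hs1
  linarith

/-- For an optimal rule `h` of a class that contains the smaller rule `g`. -/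
lemma mul_le_positiveMass_of_optimal {𝒳 : Type*} [MeasurableSpace 𝒳] {D : Measure (𝒳 × Bool)}
    [IsProbabilityMeasure D] {H : Set (𝒳 → Bool)} {c : ℝ} {g h : 𝒳 → Bool} (hg : Measurable g)
    (hh : Measurable h) (hle : ∀ x, g x ≤ h x) (hopt : h ∈ optimalRules D H c) (hgH : g ∈ H) :
    c * D.fst.real {x | h x = true ∧ g x = false} ≤
      positiveMass D {x | h x = true ∧ g x = false} := by
  have h1 := idtRisk_sub_of_le D c hg hh hle
  have h2 := hopt.2 g hgH
  linarith

/-- For an optimal rule `g` of a class that contains the larger rule `h`. -/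
lemma positiveMass_le_mul_of_optimal {𝒳 : Type*} [MeasurableSpace 𝒳] {D : Measure (𝒳 × Bool)}
    [IsProbabilityMeasure D] {H : Set (𝒳 → Bool)} {c : ℝ} {g h : 𝒳 → Bool} (hg : Measurable g)
    (hh : Measurable h) (hle : ∀ x, g x ≤ h x) (hopt : g ∈ optimalRules D H c) (hhH : h ∈ H) :
    positiveMass D {x | h x = true ∧ g x = false} ≤
      c * D.fst.real {x | h x = true ∧ g x = false} := by
  have h1 := idtRisk_sub_of_le D c hg hh hle
  have h2 := hopt.2 h hhH
  linarith

lemma MonotoneClass.le_of_pos {𝒳 : Type*} [MeasurableSpace 𝒳] {μ : Measure 𝒳}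
    {H : Set (𝒳 → Bool)} (hH : MonotoneClass H) {g h : 𝒳 → Bool} (hg : g ∈ H) (hh : h ∈ H)
    (hpos : 0 < μ.real {x | h x = true ∧ g x = false}) : ∀ x, g x ≤ h x := by
  rcases hH h hh g hg with hle | hle
  · exact hle
  · exfalso
    have : {x | h x = true ∧ g x = false} = ∅ := by
      refine eq_empty_of_forall_notMem fun x hx => ?_
      have := hle x
      rw [hx.1, hx.2] at this
      exact absurd this (by decide)
    simp [this] at hpos

/-! ### Far parameters force disagreement -/

/-- The error that the smoothness condition rules out, compared with the width `ε`. -/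
lemma smooth_error_bound {α ε p : ℝ} (hα : 0 ≤ α) (hε : 0 < ε) (hp : 0 < p) :
    (2 + α * (ε / 2)) * (p / (12 * (α / ε + 1 / ε ^ 2))) ≤ p * ε ^ 2 / 6 := by
  have hK : 12 * (α / ε + 1 / ε ^ 2) = 12 * (α * ε + 1) / ε ^ 2 := by field_simp
  have h1 : 0 ≤ α * ε := by positivity
  -- What remains is `2 + α ε / 2 ≤ 2 (α ε + 1)`; the 12 is chosen to leave `2 / 12 = 1 / 6`.
  rw [hK, div_div_eq_mul_div, mul_div_assoc', div_le_div_iff₀ (by positivity) (by norm_num)]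
  nlinarith [mul_nonneg h1 (by positivity : 0 ≤ p * ε ^ 2)]

/-- Some rule of the optimal subset of `H'` is close to the rule `h'` of the smoothness
condition. -/
lemma MDSmooth.exists_close {𝒳 : Type*} [MeasurableSpace 𝒳] {D : Measure (𝒳 × Bool)}
    [IsProbabilityMeasure D] {F : Set (Set (𝒳 → Bool))} {H H' : Set (𝒳 → Bool)} {c α η : ℝ}
    {h g : 𝒳 → Bool} (hα : 0 ≤ α) (hsmooth : MDSmooth D F H c h α) {c' : ℝ}
    (hc' : c' ∈ Ioo (0 : ℝ) 1) (hH' : H' ∈ F) (hg : g ∈ optSubset D H')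
    (hη : D.fst.real {x | g x ≠ h x} < η) :
    ∃ h' ∈ optimalRules D H c', ∃ g' ∈ optSubset D H',
      D.fst.real {x | g' x ≠ h' x} < (1 + α * |c' - c|) * η := by
  obtain ⟨h', hh', hmd⟩ := hsmooth.2 c' hc'
  refine ⟨h', hh', ?_⟩
  have hpos : 0 < 1 + α * |c' - c| := by positivity
  have h1 : minDisagreement D h (optSubset D H') ≤ ENNReal.ofReal (D.fst.real {x | g x ≠ h x}) := by
    rw [ofReal_measureReal]
    exact iInf₂_le g hg
  have h2 : minDisagreement D h' (optSubset D H') <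
      ENNReal.ofReal ((1 + α * |c' - c|) * η) := by
    refine (hmd H' hH').trans_lt ((mul_le_mul_right h1 _).trans_lt ?_)
    rw [← ENNReal.ofReal_mul hpos.le]
    exact (ENNReal.ofReal_lt_ofReal_iff (mul_pos hpos (measureReal_nonneg.trans_lt hη))).2
      (mul_lt_mul_of_pos_left hη hpos)
  -- The infimum need not be attained; the strict bound supplies a rule below it.
  simp only [minDisagreement, iInf_lt_iff] at h2
  obtain ⟨g', hg', hlt⟩ := h2
  refine ⟨g', hg', ?_⟩
  rw [← ofReal_measureReal] at hlt
  exact ENNReal.ofReal_lt_ofReal_iff'.1 hlt |>.1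

/-- A rule of the family that is optimal for a parameter far from `c` disagrees with the rule `h`
on a set of probability at least `p / (12 (α / ε + 1 / ε²))`. -/
theorem error_ge_of_parameter_far {𝒳 : Type*} [MeasurableSpace 𝒳] {D : Measure (𝒳 × Bool)}
    [IsProbabilityMeasure D] {F : Set (Set (𝒳 → Bool))} (hmeas : ∀ H ∈ F, ∀ h ∈ H, Measurable h)
    {H H' : Set (𝒳 → Bool)} (hH : H ∈ F) {c : ℝ} (hc : c ∈ Ioo (0 : ℝ) 1) {h : 𝒳 → Bool}
    (hopt : h ∈ optimalRules D H c) {α : ℝ} (hα : 0 ≤ α) (hsmooth : MDSmooth D F H c h α)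
    {ε p : ℝ} (hε : 0 < ε) (hp : 0 < p)
    (hdensity : ∀ ρ : ℝ, 0 < ρ → ρ ≤ ε →
      ENNReal.ofReal (p * ρ) ≤
          D.fst {x | ∃ t ∈ Ioo c (c + ρ), IsInducedPosterior D H x t} ∧
        ENNReal.ofReal (p * ρ) ≤
          D.fst {x | ∃ t ∈ Ioo (c - ρ) c, IsInducedPosterior D H x t})
    (hH' : H' ∈ F) {c' : ℝ} (hc' : c' ∈ Ioo (0 : ℝ) 1) {h' : 𝒳 → Bool}
    (hopt' : h' ∈ optimalRules D H' c') (hfar : ε < |c' - c|) :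
    p / (12 * (α / ε + 1 / ε ^ 2)) ≤ D.fst.real {x | h' x ≠ h x} := by
  by_contra! hlt
  set η := p / (12 * (α / ε + 1 / ε ^ 2)) with hη
  have hε1 : ε < 1 := hfar.trans (abs_lt.2 ⟨by linarith [hc.2, hc'.1], by linarith [hc.1, hc'.2]⟩)
  have hbound := smooth_error_bound hα hε hp
  rw [← hη] at hbound
  have hh := hmeas H hH h hopt.1
  have hh' := hmeas H' hH' h' hopt'.1
  have hh'opt : h' ∈ optSubset D H' := ⟨c', hc', hopt'⟩
  have hhopt : h ∈ optSubset D H := ⟨c, hc, hopt⟩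
  have hpε2 : p * ε ^ 2 ≤ p * ε := by nlinarith [mul_pos hp hε]
  obtain ⟨hdu, hdl⟩ := hdensity (ε / 2) (by positivity) (by linarith)
  -- Since `ε < 1`, `p ε / 2 - p ε² / 6 ≥ p ε / 3`.
  have key : ∀ a r : ℝ, p * (ε / 2) ≤ a + r → r < p * ε ^ 2 / 6 → p * ε / 3 < a :=
    fun a r h1 h2 => by linarith
  rcases lt_abs.1 hfar with hfar | hfar
  -- The parameter `c + ε / 2` leaves `ε / 2` towards `c` for the mass of `B` and more than `ε / 2`
  -- towards `c'` for the gap in conditional probability.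
  · have hs : c + ε / 2 ∈ Ioo (0 : ℝ) 1 := ⟨by linarith [hc.1], by linarith [hc'.2]⟩
    obtain ⟨k, hk, g, hg, hgk⟩ := hsmooth.exists_close hα hs hH' hh'opt hlt
    rw [show |c + ε / 2 - c| = ε / 2 by rw [add_sub_cancel_left, abs_of_pos (by positivity)]] at hgk
    have hgm := hmeas H' hH' g hg.choose_spec.2.1
    have hkm := hmeas H hH k hk.1
    have hB : p * (ε / 2) ≤ D.fst.real {x | h x = true ∧ k x = false} := by
      rw [measureReal_def, ← ENNReal.ofReal_le_iff_le_toReal (measure_ne_top _ _)]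
      refine hdu.trans (measure_mono ?_)
      rintro x ⟨t, ht, hq⟩
      exact ⟨true_of_lt_inducedPosterior hq (Ioo_subset_Icc_self hc) hopt ht.1,
        false_of_inducedPosterior_lt hq (Ioo_subset_Icc_self hs) hk ht.2⟩
    have hr := measureReal_disagree_sdiff_add_le D.fst hh' hgm hh hkm
    have hBA := measureReal_le_add_sdiff D.fst {x | h x = true ∧ k x = false}
      {x | h' x = true ∧ g x = false}
    have hApos := key (D.fst.real {x | h' x = true ∧ g x = false}) (D.fst.real _) (hB.trans hBA)
      (by linarith [measureReal_nonneg (μ := D.fst) (s := {x | h' x = true ∧ g x = false} \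
            {x | h x = true ∧ k x = false})])
    -- Positive mass of `A` and `B` decides which way the monotone classes order the pairs `g, h'`
    -- and `k, h`.
    have hle := (hsmooth.1 H' hH').le_of_pos hg hh'opt (lt_trans (by positivity) hApos)
    have hle' := (hsmooth.1 H hH).le_of_pos ⟨_, hs, hk⟩ hhopt (lt_of_lt_of_le (by positivity) hB)
    have := sub_mul_le_of_positiveMass D (measurableSet_disagree hgm hh')
      (measurableSet_disagree hkm hh) hs.1.le hs.2.le hr
      (positiveMass_le_mul_of_optimal hkm hh hle' hk hopt.1)
      (mul_le_positiveMass_of_optimal hgm hh' hle hopt' hg.choose_spec.2.1)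
    -- The gap times the mass of `A` exceeds `(ε / 2) (p ε / 3) = p ε² / 6`, the bound on the
    -- symmetric difference.
    have hmul := mul_le_mul_of_nonneg_right (by linarith : ε / 2 ≤ c' - (c + ε / 2))
      ((by positivity : 0 ≤ p * ε / 3).trans hApos.le)
    linarith [mul_lt_mul_of_pos_left hApos (by positivity : 0 < ε / 2)]
  · have hs : c - ε / 2 ∈ Ioo (0 : ℝ) 1 := ⟨by linarith [hc'.1], by linarith [hc.2]⟩
    obtain ⟨k, hk, g, hg, hgk⟩ := hsmooth.exists_close hα hs hH' hh'opt hlt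
    rw [show |c - ε / 2 - c| = ε / 2 by rw [sub_sub_cancel_left, abs_neg, abs_of_pos (by positivity)]]
      at hgk
    have hgm := hmeas H' hH' g hg.choose_spec.2.1
    have hkm := hmeas H hH k hk.1
    have hB : p * (ε / 2) ≤ D.fst.real {x | k x = true ∧ h x = false} := by
      rw [measureReal_def, ← ENNReal.ofReal_le_iff_le_toReal (measure_ne_top _ _)]
      refine hdl.trans (measure_mono ?_)
      rintro x ⟨t, ht, hq⟩
      exact ⟨true_of_lt_inducedPosterior hq (Ioo_subset_Icc_self hs) hk ht.1,
        false_of_inducedPosterior_lt hq (Ioo_subset_Icc_self hc) hopt ht.2⟩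
    have hr := measureReal_disagree_sdiff_add_le D.fst hgm hh' hkm hh
    have hBA := measureReal_le_add_sdiff D.fst {x | k x = true ∧ h x = false}
      {x | g x = true ∧ h' x = false}
    have hApos := key (D.fst.real {x | g x = true ∧ h' x = false}) (D.fst.real _) (hB.trans hBA)
      (by linarith [measureReal_nonneg (μ := D.fst) (s := {x | g x = true ∧ h' x = false} \
            {x | k x = true ∧ h x = false})])
    have hle := (hsmooth.1 H' hH').le_of_pos hh'opt hg (lt_trans (by positivity) hApos)
    have hle' := (hsmooth.1 H hH).le_of_pos hhopt ⟨_, hs, hk⟩ (lt_of_lt_of_le (by positivity) hB)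
    have := sub_mul_le_of_positiveMass' D (measurableSet_disagree hh' hgm)
      (measurableSet_disagree hh hkm) hs.1.le hs.2.le hr
      (mul_le_positiveMass_of_optimal hh hkm hle' hk hopt.1)
      (positiveMass_le_mul_of_optimal hh' hgm hle hopt' hg.choose_spec.2.1)
    have hmul := mul_le_mul_of_nonneg_right (by linarith : ε / 2 ≤ c - ε / 2 - c')
      ((by positivity : 0 ≤ p * ε / 3).trans hApos.le)
    linarith [mul_lt_mul_of_pos_left hApos (by positivity : 0 < ε / 2)]

/-! ### Sauer–Shelah bound for error patterns -/

/-- Weighting by powers of `t ≤ 1` gives `t ^ d ∑ C(N, k) ≤ ∑ C(N, k) t ^ k ≤ (1 + t) ^ N`. The free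
`t` is later taken proportional to the error, so that the exponential factor is harmless. -/
lemma sum_choose_le_exp (N d : ℕ) {t : ℝ} (ht0 : 0 < t) (ht1 : t ≤ 1) :
    ((∑ k ∈ Finset.Iic d, N.choose k : ℕ) : ℝ) ≤ (1 / t) ^ d * Real.exp (t * N) := by
  have h1 : ∑ k ∈ Finset.Iic d, (N.choose k : ℝ) * t ^ k ≤ (t + 1) ^ N := by
    rw [add_pow, ← Finset.sum_filter_of_ne (p := fun k => k ∈ Finset.range (N + 1))]
    · refine (Finset.sum_le_sum_of_subset_of_nonneg (t := Finset.range (N + 1)) ?_ ?_).trans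
        (le_of_eq (Finset.sum_congr rfl fun k _ => ?_))
      · exact fun k hk => (Finset.mem_filter.1 hk).2
      · intros; positivity
      · rw [one_pow, mul_one, mul_comm]
    · intro k _ hk
      by_contra hN
      rw [Finset.mem_range, not_lt] at hN
      exact hk (by rw [Nat.choose_eq_zero_of_lt hN]; simp)
  have h2 : (t + 1) ^ N ≤ Real.exp (t * N) := by
    rw [mul_comm, Real.exp_nat_mul]
    exact pow_le_pow_left₀ (by positivity) (Real.add_one_le_exp t) N
  have h3 : t ^ d * ∑ k ∈ Finset.Iic d, (N.choose k : ℝ) ≤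
      ∑ k ∈ Finset.Iic d, (N.choose k : ℝ) * t ^ k := by
    rw [Finset.mul_sum]
    refine Finset.sum_le_sum fun k hk => ?_
    rw [mul_comm]
    exact mul_le_mul_of_nonneg_left (pow_le_pow_of_le_one ht0.le ht1 (Finset.mem_Iic.1 hk))
      (Nat.cast_nonneg _)
  rw [one_div, inv_pow, inv_mul_eq_div, le_div_iff₀ (by positivity), Nat.cast_sum, mul_comm]
  exact h3.trans (h1.trans h2)

open Classical in
/-- The sets of indices of the sample `z` on which a rule of `G` disagrees with `h`. -/
noncomputable def errorPatterns {𝒳 ι : Type*} [Fintype ι] (G : Set (𝒳 → Bool)) (h : 𝒳 → Bool)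
    (z : ι → 𝒳) : Finset (Finset ι) :=
  Finset.univ.filter fun A => ∃ g ∈ G, ∀ i, i ∈ A ↔ g (z i) ≠ h (z i)

/-- Flipping labels by `h` is a bijection on labellings, so a shattered index set gives a shattered
set of points. -/
lemma vcDim_errorPatterns_le {𝒳 ι : Type*} [Fintype ι] [DecidableEq ι] {G : Set (𝒳 → Bool)}
    {d : ℕ} (hd : classVCDim G ≤ d) (h : 𝒳 → Bool) (z : ι → 𝒳) :
    (errorPatterns G h z).vcDim ≤ d := by
  classical
  refine Finset.sup_le fun s hs => ?_
  rw [Finset.mem_shatterer] at hs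
  have hs' : ∀ t ⊆ s, ∃ g ∈ G, ∀ i ∈ s, i ∈ t ↔ g (z i) ≠ h (z i) := by
    intro t ht
    obtain ⟨u, hu, rfl⟩ := hs ht
    obtain ⟨g, hg, hgu⟩ := (Finset.mem_filter.1 hu).2
    exact ⟨g, hg, fun i hi => by rw [Finset.mem_inter, hgu]; exact and_iff_right hi⟩
  -- Equal points get equal labels, so no pattern could separate their indices.
  have hinj : Set.InjOn z s := by
    intro i hi j hj hij
    by_contra hne
    obtain ⟨g, -, hg⟩ := hs' {i} (Finset.singleton_subset_iff.2 hi)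
    have h1 := (hg i hi).1 (Finset.mem_singleton_self i)
    rw [hij] at h1
    exact hne (Finset.mem_singleton.1 ((hg j hj).2 h1)).symm
  have hsh : ClassShatters G (s.image z) := by
    intro f
    obtain ⟨g, hg, hgs⟩ := hs' (s.filter fun i => f (z i) ≠ h (z i)) (Finset.filter_subset _ _)
    refine ⟨g, hg, fun x hx => ?_⟩
    obtain ⟨i, hi, rfl⟩ := Finset.mem_image.1 hx
    have h1 := hgs i hi
    rw [Finset.mem_filter, and_iff_right hi] at h1
    revert h1
    cases f (z i) <;> cases g (z i) <;> cases h (z i) <;> simp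
  have h2 := (le_iSup (fun S : {S : Finset 𝒳 // ClassShatters G S} => (S.1.card : ℕ∞))
    ⟨s.image z, hsh⟩).trans hd
  rw [Finset.card_image_of_injOn hinj] at h2
  exact_mod_cast h2

lemma card_errorPatterns_le {𝒳 ι : Type*} [Fintype ι] {G : Set (𝒳 → Bool)}
    {d : ℕ} (hd : classVCDim G ≤ d) (h : 𝒳 → Bool) (z : ι → 𝒳) :
    (errorPatterns G h z).card ≤ ∑ k ∈ Finset.Iic d, (Fintype.card ι).choose k := by
  classical
  exact (Finset.card_le_card_shatterer _).trans (Finset.card_shatterer_le_sum_vcDim.trans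
    (Finset.sum_le_sum_of_subset (Finset.Iic_subset_Iic.2 (vcDim_errorPatterns_le hd h z))))

/-! ### Symmetrization by random swaps -/

/-- At most a fraction `2⁻ᵏ` of the swaps `σ` put `k` or more errors, and all errors there are,
into the second sample. -/
lemma card_swaps_mul_le {m k : ℕ} (A : Finset (Fin m × Bool)) :
    (Finset.univ.filter fun σ : Fin m → Bool => (∀ i, (i, σ i) ∉ A) ∧
      k ≤ (Finset.univ.filter fun i => (i, !σ i) ∈ A).card).card * 2 ^ k ≤ 2 ^ m := by
  rcases Finset.eq_empty_or_nonempty (Finset.univ.filter fun σ : Fin m → Bool =>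
    (∀ i, (i, σ i) ∉ A) ∧ k ≤ (Finset.univ.filter fun i => (i, !σ i) ∈ A).card) with he | ⟨τ, hτ⟩
  · rw [he, Finset.card_empty, zero_mul]; exact Nat.zero_le _
  have hτ' := (Finset.mem_filter.1 hτ).2
  set J := Finset.univ.filter fun i => (i, !τ i) ∈ A with hJ
  -- Fix one admissible swap `τ`. Any other must agree with it on `J`, since flipping an index of
  -- `J` would move an error into the first sample; so at least `k` bits are forced.
  have hsub : (Finset.univ.filter fun σ : Fin m → Bool => (∀ i, (i, σ i) ∉ A) ∧
      k ≤ (Finset.univ.filter fun i => (i, !σ i) ∈ A).card) ⊆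
      Fintype.piFinset fun i => if i ∈ J then {τ i} else Finset.univ := by
    intro σ hσ
    rw [Fintype.mem_piFinset]
    intro i
    split_ifs with hi
    · rw [Finset.mem_singleton]
      by_contra hne
      have h1 : σ i = !τ i := by revert hne; cases σ i <;> cases τ i <;> simp
      exact (Finset.mem_filter.1 hσ).2.1 i (h1 ▸ (Finset.mem_filter.1 hi).2)
    · exact Finset.mem_univ _
  calc _ ≤ (∏ i, if i ∈ J then 1 else 2) * 2 ^ J.card := by
        refine Nat.mul_le_mul ((Finset.card_le_card hsub).trans (le_of_eq ?_))
          (Nat.pow_le_pow_right two_pos hτ'.2)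
        rw [Fintype.card_piFinset]
        refine Finset.prod_congr rfl fun i _ => ?_
        split_ifs <;> simp
    _ = (∏ i, if i ∈ J then 1 else 2) * ∏ i, if i ∈ J then 2 else 1 := by
        rw [Finset.prod_ite_mem, Finset.univ_inter, Finset.prod_const]
    _ = 2 ^ m := by
        rw [← Finset.prod_mul_distrib, Finset.prod_congr rfl (g := fun _ => 2)]
        · simp
        · intro i _
          split_ifs <;> rfl

/-- Averaging: every `T i` keeps the measure of `W`, so the sum of these measures is the integral of
the number of `i` that send `s` into `W`. -/
lemma card_mul_measure_le_of_measurePreserving {Ω ι : Type*} [MeasurableSpace Ω] [Fintype ι]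
    {μ : Measure Ω} [IsProbabilityMeasure μ] {T : ι → Ω → Ω}
    (hT : ∀ i, MeasurePreserving (T i) μ μ) {W : Set Ω} (hW : NullMeasurableSet W μ) {M : ℕ}
    (hM : ∀ s, ({i | T i s ∈ W} : Set ι).ncard ≤ M) :
    (Fintype.card ι : ℝ≥0∞) * μ W ≤ M := by
  classical
  have hn : ∀ i, NullMeasurableSet (T i ⁻¹' W) μ := fun i => hW.preimage (hT i).quasiMeasurePreserving
  calc (Fintype.card ι : ℝ≥0∞) * μ W = ∑ i, μ (T i ⁻¹' W) := by
        simp [(hT _).measure_preimage hW]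
    _ = ∫⁻ s, ∑ i, (T i ⁻¹' W).indicator 1 s ∂μ := by
        rw [lintegral_finsetSum']
        · exact Finset.sum_congr rfl fun i _ => (lintegral_indicator_one₀ (hn i)).symm
        · exact fun i _ => aemeasurable_one.indicator₀ (hn i)
    _ ≤ ∫⁻ _, M ∂μ := by
        refine lintegral_mono fun s => ?_
        have : ∑ i, (T i ⁻¹' W).indicator (1 : Ω → ℝ≥0∞) s =
            ((Finset.univ.filter fun i => T i s ∈ W).card : ℝ≥0∞) := by
          simp [indicator]
        rw [this, Nat.cast_le]
        refine le_trans (le_of_eq ?_) (hM s)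
        rw [← Set.ncard_coe_finset]
        congr 1
        ext i
        simp
    _ = M := by simp

/-- Exchanges the two samples at the indices that `σ` selects. -/
def swapSamples {𝒳 : Type*} {m : ℕ} (σ : Fin m → Bool) (s : (Fin m → 𝒳) × (Fin m → 𝒳)) :
    (Fin m → 𝒳) × (Fin m → 𝒳) :=
  (fun i => if σ i then s.2 i else s.1 i, fun i => if σ i then s.1 i else s.2 i)

lemma measurePreserving_swapSamples {𝒳 : Type*} [MeasurableSpace 𝒳] (P : Measure 𝒳)
    [IsProbabilityMeasure P] {m : ℕ} (σ : Fin m → Bool) :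
    MeasurePreserving (swapSamples (𝒳 := 𝒳) σ)
      ((Measure.pi fun _ : Fin m => P).prod (Measure.pi fun _ : Fin m => P))
      ((Measure.pi fun _ : Fin m => P).prod (Measure.pi fun _ : Fin m => P)) := by
  have h1 := measurePreserving_arrowProdEquivProdArrow 𝒳 𝒳 (Fin m) (fun _ => P) (fun _ => P)
  have h2 : MeasurePreserving
      (fun (a : Fin m → 𝒳 × 𝒳) i => (if σ i then Prod.swap else id) (a i))
      (Measure.pi fun _ => P.prod P) (Measure.pi fun _ => P.prod P) := by
    refine measurePreserving_pi _ _ fun i => ?_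
    split_ifs
    · exact Measure.measurePreserving_swap
    · exact MeasurePreserving.id _
  have h3 := (h1.comp h2).comp (h1.symm _)
  convert h3 using 1
  funext s
  refine Prod.ext (funext fun i => ?_) (funext fun i => ?_) <;>
    cases hi : σ i <;>
    simp [swapSamples, hi, MeasurableEquiv.arrowProdEquivProdArrow, Equiv.arrowProdEquivProdArrow]

/-- The double samples on which some rule of error at least `η` is right on the first sample and
wrong at least `η n / 2` times on the second one. -/
def badDoubleSamples {𝒳 : Type*} [MeasurableSpace 𝒳] (P : Measure 𝒳) (h : 𝒳 → Bool)
    (G : Set (𝒳 → Bool)) (n : ℕ) (η : ℝ) : Set ((Fin n → 𝒳) × (Fin n → 𝒳)) :=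
  {s | ∃ g ∈ G, ENNReal.ofReal η ≤ P {x | g x ≠ h x} ∧
        (∀ i, g (s.1 i) = h (s.1 i)) ∧
        η * n / 2 ≤ ((Finset.univ.filter fun i => g (s.2 i) ≠ h (s.2 i)).card : ℝ)}

lemma ncard_swapSamples_mem_le {𝒳 : Type*} [MeasurableSpace 𝒳] (P : Measure 𝒳) (h : 𝒳 → Bool)
    {G : Set (𝒳 → Bool)} {d : ℕ} (hd : classVCDim G ≤ d) (m : ℕ) (η : ℝ)
    (s : (Fin m → 𝒳) × (Fin m → 𝒳)) :
    ({σ | swapSamples σ s ∈ badDoubleSamples P h G m η} : Set (Fin m → Bool)).ncard *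
        2 ^ ⌈η * m / 2⌉₊ ≤ (∑ j ∈ Finset.Iic d, (2 * m).choose j) * 2 ^ m := by
  classical
  set k := ⌈η * m / 2⌉₊
  let z : Fin m × Bool → 𝒳 := fun q => if q.2 then s.2 q.1 else s.1 q.1
  let S : Finset (Fin m × Bool) → Finset (Fin m → Bool) := fun A =>
    Finset.univ.filter fun σ : Fin m → Bool => (∀ i, (i, σ i) ∉ A) ∧
      k ≤ (Finset.univ.filter fun i => (i, !σ i) ∈ A).card
  have hsub : ({σ | swapSamples σ s ∈ badDoubleSamples P h G m η} : Set (Fin m → Bool)) ⊆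
      ((errorPatterns G h z).biUnion S : Finset (Fin m → Bool)) := by
    rintro σ ⟨g, hg, -, h1, h2⟩
    rw [Finset.mem_coe, Finset.mem_biUnion]
    have hz1 : ∀ i, (swapSamples σ s).1 i = z (i, σ i) := fun i => rfl
    have hz2 : ∀ i, (swapSamples σ s).2 i = z (i, !σ i) := fun i => by
      cases hi : σ i <;> simp [swapSamples, z, hi]
    refine ⟨Finset.univ.filter fun q => g (z q) ≠ h (z q), Finset.mem_filter.2
      ⟨Finset.mem_univ _, g, hg, fun i => by simp⟩, Finset.mem_filter.2
      ⟨Finset.mem_univ _, fun i => ?_, ?_⟩⟩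
    · simpa [hz1] using h1 i
    · refine Nat.ceil_le.2 (h2.trans (le_of_eq ?_))
      simp [hz2]
  calc _ ≤ ((errorPatterns G h z).biUnion S).card * 2 ^ k := by
        refine Nat.mul_le_mul_right _ ?_
        rw [← Set.ncard_coe_finset]
        exact Set.ncard_le_ncard hsub (Finset.finite_toSet _)
    _ ≤ (∑ A ∈ errorPatterns G h z, (S A).card) * 2 ^ k :=
        Nat.mul_le_mul_right _ Finset.card_biUnion_le
    _ ≤ (errorPatterns G h z).card * 2 ^ m := by
        rw [Finset.sum_mul, ← smul_eq_mul]
        exact Finset.sum_le_card_nsmul _ _ _ fun A _ => card_swaps_mul_le A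
    _ ≤ _ := by
        refine Nat.mul_le_mul_right _ ((card_errorPatterns_le hd h z).trans (le_of_eq ?_))
        simp [mul_comm]

lemma measure_badDoubleSamples_le {𝒳 : Type*} [MeasurableSpace 𝒳] (P : Measure 𝒳)
    [IsProbabilityMeasure P] {h : 𝒳 → Bool} {G : Set (𝒳 → Bool)} {d : ℕ}
    (hd : classVCDim G ≤ d) (hwb : WellBehaved P h G) (m : ℕ) {η : ℝ} (hη : 0 < η) :
    ((Measure.pi fun _ : Fin m => P).prod (Measure.pi fun _ : Fin m => P)).real
        (badDoubleSamples P h G m η) * 2 ^ ⌈η * m / 2⌉₊ ≤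
      (∑ j ∈ Finset.Iic d, (2 * m).choose j : ℕ) := by
  set μ := (Measure.pi fun _ : Fin m => P).prod (Measure.pi fun _ : Fin m => P)
  set k := ⌈η * m / 2⌉₊
  set N := ∑ j ∈ Finset.Iic d, (2 * m).choose j
  have h1 := card_mul_measure_le_of_measurePreserving (μ := μ)
    (measurePreserving_swapSamples P) (hwb m η hη) (M := N * 2 ^ m / 2 ^ k) fun s =>
      (Nat.le_div_iff_mul_le (by positivity)).2 (ncard_swapSamples_mem_le P h hd m η s)
  have h2 := ENNReal.toReal_mono (ENNReal.natCast_ne_top _) h1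
  rw [ENNReal.toReal_mul, ENNReal.toReal_natCast, ENNReal.toReal_natCast] at h2
  have h3 : ((N * 2 ^ m / 2 ^ k : ℕ) : ℝ) ≤ N * 2 ^ m / 2 ^ k := by
    refine Nat.cast_div_le.trans (le_of_eq ?_)
    push_cast
    rfl
  have h4 := h2.trans h3
  rw [le_div_iff₀ (by positivity)] at h4
  have h5 : (Fintype.card (Fin m → Bool) : ℝ) = 2 ^ m := by simp
  rw [h5, mul_assoc, mul_comm (N : ℝ)] at h4
  exact le_of_mul_le_mul_left h4 (by positivity)

/-! ### Double sampling and the realizable PAC bound -/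

/-- A lower tail bound for the number of sample points in `A`. -/
lemma half_le_measure_card_ge {𝒳 : Type*} [MeasurableSpace 𝒳] (P : Measure 𝒳)
    [IsProbabilityMeasure P] {A : Set 𝒳} [DecidablePred (· ∈ A)] (hA : MeasurableSet A) {m : ℕ}
    {η : ℝ} (hη : η ≤ P.real A) (hm : 8 ≤ η * m) :
    1 / 2 ≤ (Measure.pi fun _ : Fin m => P).real
      {y | η * m / 2 ≤ ((Finset.univ.filter fun i => y i ∈ A).card : ℝ)} := by
  set μ := Measure.pi fun _ : Fin m => P
  -- Chernoff's method with base `1 / 2`: the product of the `f (y i)` is `2` to the minus number of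
  -- hits.
  set f : 𝒳 → ℝ := fun x => 1 - A.indicator (fun _ => (1 / 2 : ℝ)) x with hf
  have hfi : Integrable f P := (integrable_const 1).sub ((integrable_const _).indicator hA)
  have hfx : ∀ x, f x = if x ∈ A then 1 / 2 else 1 := fun x => by
    by_cases hx : x ∈ A
    · simp [hf, hx]; norm_num
    · simp [hf, hx]
  have hint : ∫ x, f x ∂P = 1 - P.real A / 2 := by
    rw [hf, integral_sub (integrable_const 1) ((integrable_const _).indicator hA),
      integral_indicator_const _ hA]
    simp
    ring
  have hprod : ∀ y : Fin m → 𝒳,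
      ∏ i, f (y i) = Real.exp (-(Real.log 2 * (Finset.univ.filter fun i => y i ∈ A).card)) := by
    intro y
    simp_rw [hfx]
    rw [Finset.prod_ite, Finset.prod_const_one, mul_one, Finset.prod_const, Real.exp_neg,
      mul_comm, Real.exp_nat_mul, Real.exp_log two_pos, one_div, inv_pow]
  have hmeasS : MeasurableSet
      {y : Fin m → 𝒳 | η * m / 2 ≤ ((Finset.univ.filter fun i => y i ∈ A).card : ℝ)} := by
    have hc : Measurable fun y : Fin m → 𝒳 =>
        ((Finset.univ.filter fun i => y i ∈ A).card : ℝ) := by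
      simp_rw [Finset.card_filter, Nat.cast_sum]
      refine Finset.measurable_sum _ fun i _ => ?_
      have : Measurable fun x : 𝒳 => ((if x ∈ A then 1 else 0 : ℕ) : ℝ) := by
        have h0 : Measurable fun x : 𝒳 => (if x ∈ A then 1 else 0 : ℕ) :=
          Measurable.ite hA measurable_const measurable_const
        exact measurable_from_top.comp h0
      exact this.comp (measurable_pi_apply i)
    exact measurableSet_le measurable_const hc
  set S := {y : Fin m → 𝒳 | η * m / 2 ≤ ((Finset.univ.filter fun i => y i ∈ A).card : ℝ)}
  set b := Real.exp (-(Real.log 2 * (η * m / 2)))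
  have hmarkov := mul_meas_ge_le_integral_of_nonneg (μ := μ)
    (f := fun y : Fin m → 𝒳 => ∏ i, f (y i))
    (ae_of_all _ fun y => by
      simp only [hprod, Pi.zero_apply]; positivity)
    (Integrable.fintype_prod fun _ => hfi) b
  rw [integral_fintype_prod_eq_pow, hint, Fintype.card_fin] at hmarkov
  have hsub : Sᶜ ⊆ {y : Fin m → 𝒳 | b ≤ ∏ i, f (y i)} := by
    intro y hy
    have hy' : ((Finset.univ.filter fun i => y i ∈ A).card : ℝ) < η * m / 2 := not_le.1 hy
    rw [mem_ofPred_eq, hprod, Real.exp_le_exp, neg_le_neg_iff]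
    exact mul_le_mul_of_nonneg_left hy'.le (Real.log_nonneg one_le_two)
  have hle1 : P.real A ≤ 1 := measureReal_le_one
  have hpow : (1 - P.real A / 2) ^ m ≤ Real.exp (-(η * m / 2)) := by
    have h1 : 1 - P.real A / 2 ≤ Real.exp (-(η / 2)) := by
      have := Real.add_one_le_exp (-(η / 2))
      linarith
    refine (pow_le_pow_left₀ (by linarith) h1 m).trans (le_of_eq ?_)
    rw [← Real.exp_nat_mul]
    congr 1
    ring
  have hcompl : b * μ.real Sᶜ ≤ b * (1 / 2) := by
    refine (mul_le_mul_of_nonneg_left (measureReal_mono hsub) (Real.exp_nonneg _)).trans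
      (hmarkov.trans (hpow.trans ?_))
    rw [one_div, ← Real.exp_log two_pos, ← Real.exp_neg, ← Real.exp_add, Real.exp_le_exp,
      Real.exp_log two_pos]
    -- The claim is `(1 - log 2) η m / 2 ≥ log 2`, which `η m ≥ 8` ensures.
    nlinarith [Real.log_two_lt_d9]
  have h2 := le_of_mul_le_mul_left hcompl (Real.exp_pos _)
  rw [probReal_compl_eq_one_sub hmeasS] at h2
  linarith

/-- The realizable case of the fundamental theorem of PAC learning: with high probability, all
rules of a class of finite VC-dimension that agree with `h` on the sample have small error. -/
theorem exists_measurableSet_consistent_error_lt {𝒳 : Type*} [MeasurableSpace 𝒳] (P : Measure 𝒳)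
    [IsProbabilityMeasure P] {h : 𝒳 → Bool} (hh : Measurable h) {G : Set (𝒳 → Bool)}
    (hG : ∀ g ∈ G, Measurable g) {d : ℕ} (hd : classVCDim G ≤ d) (hwb : WellBehaved P h G)
    {m : ℕ} {η δ : ℝ} (hη : 0 < η) (hη1 : η ≤ 1) (hδ : 0 < δ) (hm : 8 ≤ η * m)
    (hm' : 5 * (d * Real.log (16 / η) + Real.log (2 / δ)) ≤ η * m) :
    ∃ E : Set (Fin m → 𝒳), MeasurableSet E ∧
      ENNReal.ofReal (1 - δ) ≤ (Measure.pi fun _ : Fin m => P) E ∧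
      ∀ x ∈ E, ∀ g ∈ G, (∀ i, g (x i) = h (x i)) → P.real {x | g x ≠ h x} < η := by
  set μ := Measure.pi fun _ : Fin m => P
  set W := badDoubleSamples P h G m η
  -- `W` is only null measurable; its measurable hull has the same measure, and its sections depend
  -- measurably on `x`.
  set V := toMeasurable (μ.prod μ) W
  have hV : MeasurableSet V := measurableSet_toMeasurable _ _
  have hφ : Measurable fun x => μ (Prod.mk x ⁻¹' V) := measurable_measure_prodMk_left hV
  have hB : MeasurableSet {x | (1 / 2 : ℝ≥0∞) ≤ μ (Prod.mk x ⁻¹' V)} :=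
    measurableSet_le measurable_const hφ
  refine ⟨{x | (1 / 2 : ℝ≥0∞) ≤ μ (Prod.mk x ⁻¹' V)}ᶜ, hB.compl, ?_, ?_⟩
  · have hmarkov := mul_meas_ge_le_lintegral (μ := μ) hφ (1 / 2)
    rw [← Measure.prod_apply hV, measure_toMeasurable] at hmarkov
    have h1 := ENNReal.toReal_mono (measure_ne_top _ _) hmarkov
    rw [ENNReal.toReal_mul, ← measureReal_def, ← measureReal_def] at h1
    have h2 := measure_badDoubleSamples_le P hd hwb m hη
    -- With `t = η / 16` the exponential factor is `exp (η m / 8)`, and `log 2 / 2 - 1 / 8 > 1 / 5`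
    -- accounts for the 5 in `hm'`.
    have h3 := sum_choose_le_exp (2 * m) d (t := η / 16) (by positivity) (by linarith)
    have h4 : Real.exp (Real.log 2 * (η * m / 2)) ≤ 2 ^ ⌈η * m / 2⌉₊ := by
      rw [← Real.exp_log (by positivity : (0 : ℝ) < 2 ^ ⌈η * m / 2⌉₊), Real.exp_le_exp,
        Real.log_pow, mul_comm]
      exact mul_le_mul_of_nonneg_right (Nat.le_ceil _) (Real.log_nonneg one_le_two)
    have h5 : (1 / (η / 16)) ^ d * Real.exp (η / 16 * (2 * m : ℕ)) ≤
        δ / 2 * Real.exp (Real.log 2 * (η * m / 2)) := by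
      rw [one_div_div, ← Real.exp_log (by positivity : (0 : ℝ) < 16 / η), ← Real.exp_nat_mul,
        ← Real.exp_log (by positivity : (0 : ℝ) < δ / 2), ← Real.exp_add, ← Real.exp_add,
        Real.exp_le_exp]
      have h6 : Real.log (δ / 2) = -Real.log (2 / δ) := by rw [← Real.log_inv, inv_div]
      rw [h6]
      push_cast
      nlinarith [mul_le_mul_of_nonneg_right Real.log_two_gt_d9.le (by linarith : 0 ≤ η * m)]
    have h7 : (μ.prod μ).real W * Real.exp (Real.log 2 * (η * m / 2)) ≤
        δ / 2 * Real.exp (Real.log 2 * (η * m / 2)) :=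
      (mul_le_mul_of_nonneg_left h4 measureReal_nonneg).trans (h2.trans (h3.trans h5))
    have h8 := le_of_mul_le_mul_right h7 (Real.exp_pos _)
    have h9 : μ.real {x | (1 / 2 : ℝ≥0∞) ≤ μ (Prod.mk x ⁻¹' V)} ≤ δ := by
      have : (1 / 2 : ℝ≥0∞).toReal = 1 / 2 := by simp
      rw [this] at h1
      linarith
    rw [← ofReal_measureReal, probReal_compl_eq_one_sub hB]
    exact ENNReal.ofReal_le_ofReal (by linarith)
  · intro x hx g hg hgx
    by_contra! herr
    refine hx ?_
    -- A fresh second sample exposes the bad rule `g` with probability at least `1 / 2`, so the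
    -- section of `V` over `x` is large.
    have h1 := half_le_measure_card_ge P (measurableSet_ne_rule (hG g hg) hh) herr hm
    have h2 : (1 / 2 : ℝ≥0∞) = ENNReal.ofReal (1 / 2) := by
      rw [ENNReal.ofReal_div_of_pos two_pos]; simp
    rw [mem_ofPred_eq, h2]
    refine (ENNReal.ofReal_le_ofReal h1).trans ?_
    rw [ofReal_measureReal]
    refine measure_mono fun y hy => subset_toMeasurable _ _ ⟨g, hg, ?_, hgx, hy⟩
    rw [← ofReal_measureReal]
    exact ENNReal.ofReal_le_ofReal herr

/-! ### Sample size and conclusion -/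

lemma eq_of_classVCDim_le_zero {𝒳 : Type*} {G : Set (𝒳 → Bool)} (hG : classVCDim G ≤ (0 : ℕ))
    {g h : 𝒳 → Bool} (hg : g ∈ G) (hh : h ∈ G) : g = h := by
  funext x
  by_contra hne
  have hsh : ClassShatters G {x} := by
    intro f
    by_cases hf : g x = f x
    · exact ⟨g, hg, fun y hy => by rw [Finset.mem_singleton.1 hy, hf]⟩
    · refine ⟨h, hh, fun y hy => ?_⟩
      rw [Finset.mem_singleton.1 hy]
      revert hne hf
      cases g x <;> cases h x <;> cases f x <;> simp
  have := (le_iSup (fun S : {S : Finset 𝒳 // ClassShatters G S} => (S.1.card : ℕ∞))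
    ⟨{x}, hsh⟩).trans hG
  simp at this

/-- The sample size of the theorem is large enough for the error `p / (12 K)`. -/
lemma sample_size_bound {d : ℕ} (hd : 1 ≤ d) {K p δ m : ℝ} (hK : 0 < K) (hp : 0 < p) (hδ : 0 < δ)
    (hδ1 : δ < 1)
    (hm : 600 * (K * ((d * Real.log (2 + K / p) + Real.log (1 / δ)) / p)) ≤ m) :
    8 ≤ p / (12 * K) * m ∧
      5 * (d * Real.log (16 / (p / (12 * K))) + Real.log (2 / δ)) ≤ p / (12 * K) * m := by
  set L := Real.log (2 + K / p) with hL
  have hKp : 0 < K / p := by positivity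
  have hL2 : Real.log 2 ≤ L := Real.log_le_log two_pos (by linarith)
  have hd' : (1 : ℝ) ≤ d := by exact_mod_cast hd
  have hlog2 := Real.log_two_gt_d9
  have hdL : L ≤ d * L := le_mul_of_one_le_left (by linarith) hd'
  have hδ' : 0 ≤ Real.log (1 / δ) := Real.log_nonneg (by rw [le_div_iff₀ hδ]; linarith)
  -- Here `50 = 600 / 12`; below, `5 · 9 = 45` of the 50 copies of `d L` absorb the logarithm and
  -- the rest covers `5 log 2`.
  have h1 : 50 * (d * L + Real.log (1 / δ)) ≤ p / (12 * K) * m := by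
    refine le_trans (le_of_eq ?_) (mul_le_mul_of_nonneg_left hm (by positivity))
    field_simp
    ring
  have h2 : Real.log (16 / (p / (12 * K))) ≤ 9 * L := by
    have h3 : 16 / (p / (12 * K)) ≤ 2 ^ 8 * (2 + K / p) := by
      have : 16 / (p / (12 * K)) = 192 * (K / p) := by field_simp; ring
      rw [this]
      linarith
    refine (Real.log_le_log (by positivity) h3).trans ?_
    rw [Real.log_mul (by positivity) (by positivity), Real.log_pow, ← hL]
    push_cast
    linarith
  have h4 : Real.log (2 / δ) = Real.log 2 + Real.log (1 / δ) := by
    rw [← Real.log_mul two_ne_zero (by positivity), mul_one_div]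
  have h5 := mul_le_mul_of_nonneg_left h2 (by positivity : (0 : ℝ) ≤ d)
  constructor
  · linarith
  · rw [h4]
    linarith

theorem theorem3 :
    ∃ C : ℝ, 0 < C ∧
      ∀ (𝒳 : Type*) [MeasurableSpace 𝒳] (D : Measure (𝒳 × Bool)) [IsProbabilityMeasure D]
        (F : Set (Set (𝒳 → Bool))) (_hmeas : ∀ H ∈ F, ∀ h ∈ H, Measurable h)
        (H : Set (𝒳 → Bool)) (_hH : H ∈ F)
        (c : ℝ) (_hc : c ∈ Ioo (0 : ℝ) 1) (h : 𝒳 → Bool) (_hopt : h ∈ optimalRules D H c)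
        (α : ℝ) (_hα : 0 ≤ α) (_hsmooth : MDSmooth D F H c h α)
        (ε : ℝ) (_hε : 0 < ε) (δ : ℝ) (_hδ : 0 < δ) (p : ℝ) (_hp : 0 < p)
        (_hdensity : ∀ ρ : ℝ, 0 < ρ → ρ ≤ ε →
          ENNReal.ofReal (p * ρ) ≤
              D.fst {x | ∃ t ∈ Ioo c (c + ρ), IsInducedPosterior D H x t} ∧
            ENNReal.ofReal (p * ρ) ≤
              D.fst {x | ∃ t ∈ Ioo (c - ρ) c, IsInducedPosterior D H x t})
        (d : ℕ) (_hd : classVCDim (⋃₀ F) ≤ (d : ℕ∞))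
        (_hwb : WellBehaved D.fst h (⋃₀ F))
        (m : ℕ)
        (_hm : C * ((α / ε + 1 / ε ^ 2) *
            ((d * Real.log (2 + (α / ε + 1 / ε ^ 2) / p) + Real.log (1 / δ)) / p)) ≤ (m : ℝ)),
        ∃ E : Set (Fin m → 𝒳), MeasurableSet E ∧
          ENNReal.ofReal (1 - δ) ≤ (Measure.pi fun _ : Fin m => D.fst) E ∧
          ∀ x ∈ E, ∀ H' ∈ F, ∀ c' ∈ Ioo (0 : ℝ) 1, ∀ h' ∈ optimalRules D H' c',
            (∀ i, h' (x i) = h (x i)) → |c' - c| ≤ ε := by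
  refine ⟨600, by norm_num, ?_⟩
  intro 𝒳 _ D _ F hmeas H hH c hc h hopt α hα hsmooth ε hε δ hδ p hp hdensity d hd hwb m hm
  rcases le_or_gt 1 δ with hδ1 | hδ1
  · exact ⟨∅, MeasurableSet.empty, by simp [ENNReal.ofReal_eq_zero.2 (sub_nonpos.2 hδ1)],
      fun x hx => absurd hx (notMem_empty x)⟩
  have hfar : ∀ H' ∈ F, ∀ c' ∈ Ioo (0 : ℝ) 1, ∀ h' ∈ optimalRules D H' c',
      D.fst.real {x | h' x ≠ h x} < p / (12 * (α / ε + 1 / ε ^ 2)) → |c' - c| ≤ ε := by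
    intro H' hH' c' hc' h' hopt' hlt
    by_contra! hfar
    exact hlt.not_ge (error_ge_of_parameter_far hmeas hH hc hopt hα hsmooth hε hp hdensity hH' hc'
      hopt' hfar)
  have hK : 0 < α / ε + 1 / ε ^ 2 := by positivity
  have huniv : ENNReal.ofReal (1 - δ) ≤ (Measure.pi fun _ : Fin m => D.fst) univ := by
    rw [measure_univ]
    exact ENNReal.ofReal_le_one.2 (by linarith)
  -- For `d = 0` the bound on `m` may be too weak for the PAC step, but then all rules of the family
  -- coincide and no sample is needed.
  rcases Nat.eq_zero_or_pos d with rfl | hd0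
  · refine ⟨univ, MeasurableSet.univ, huniv, fun x _ H' hH' c' hc' h' hopt' _ =>
      hfar H' hH' c' hc' h' hopt' ?_⟩
    rw [eq_of_classVCDim_le_zero hd ⟨H', hH', hopt'.1⟩ ⟨H, hH, hopt.1⟩]
    simp only [ne_eq, not_true_eq_false, ofPred_false, measureReal_empty]
    positivity
  rcases le_or_gt 1 ε with hε1 | hε1
  · refine ⟨univ, MeasurableSet.univ, huniv, fun x _ H' hH' c' hc' h' hopt' _ => ?_⟩
    exact (abs_le.2 ⟨by linarith [hc.2, hc'.1], by linarith [hc.1, hc'.2]⟩).trans hε1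
  -- A probability is at most 1; with `ε < 1` this yields `p ≤ 1 / ε²`, hence `η ≤ 1`.
  have hpε : p * ε ≤ 1 := by
    have := (hdensity ε hε le_rfl).1.trans prob_le_one
    exact ENNReal.ofReal_le_one.1 this
  have hη1 : p / (12 * (α / ε + 1 / ε ^ 2)) ≤ 1 := by
    have h1 : p * ε ^ 2 ≤ 1 := by nlinarith
    have h2 : p ≤ 1 / ε ^ 2 := by rwa [le_div_iff₀ (by positivity)]
    have h3 : 0 ≤ α / ε := by positivity
    rw [div_le_one (by positivity)]
    linarith
  obtain ⟨hm1, hm2⟩ := sample_size_bound hd0 hK hp hδ hδ1 hm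
  obtain ⟨E, hE, hPE, hcons⟩ := exists_measurableSet_consistent_error_lt D.fst
    (hmeas H hH h hopt.1) (fun g hg => hmeas _ hg.choose_spec.1 g hg.choose_spec.2) hd hwb (by positivity) hη1 hδ
    hm1 hm2
  exact ⟨E, hE, hPE, fun x hx H' hH' c' hc' h' hopt' hcx =>
    hfar H' hH' c' hc' h' hopt' (hcons x hx h' ⟨H', hH', hopt'.1⟩ hcx)⟩
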